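/- **Proposition (characterization of Wolstenholme primes).** A prime $p$ is called a *Wolstenholme prime* if $\binom{2p-1}{p-1} \equiv 1 \pmod{p^4}$. Throughout, $\binom{l}{r} = 0$ for nonnegative integers $l < r$, and $\binom{0}{0} = 1$. For a prime $p \ge 5$ the following statements are equivalent: (i) $p$ is a Wolstenholme prime; (i$'$) $\binom{2p}{p} \equiv 2 \pmod{p^4}$; (ii) for all nonnegative integers $n$ and $m$, $$\binom{np}{mp} \equiv \binom{n}{m} \pmod{p^4};$$ (iii) for all nonnegative integers $n, m, n_0, m_0$ with $n_0 < p$ and $m_0 < p$, $$\binom{np^4+n_0}{mp^4+m_0} \equiv \binom{n}{m}\binom{n_0}{m_0} \pmod{p^4}.$$ -/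

import Mathlib

/-- A prime `p` is a Wolstenholme prime if `binom(2p - 1, p - 1) ≡ 1 (mod p ^ 4)`.
For a prime `p` the natural-number subtractions below do not truncate. -/
def IsWolstenholmePrime (p : ℕ) : Prop :=
  p.Prime ∧ (2 * p - 1).choose (p - 1) ≡ 1 [MOD p ^ 4]

open Polynomial Finset
open scoped Nat

/-! Let q = (X+1)⋯(X+p-1) and G(n) = ∏_{k<n} q(kp). Since (np)! = pⁿ n! G(n), the ratio of binom(np,
mp) to binom(n, m) is G(n)/(G(m)G(n-m)). The middle coefficients of q are divisible by p, and q(-p)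
= q(0) ties the linear one to the quadratic one. Hence q(kp) ≡ (p-1)! + p³a·k(k+1) mod p⁴, and the
correction to G(n) is governed by a·S(n), where S(n) = ∑_{k<n} k(k+1). The case n = 2, m = 1 shows
that (i') forces p ∣ a, which removes every correction and gives (ii). Vandermonde then gives (iii).
For the return, p ∣ S(n) whenever p ∣ n, so binom(2pᵉ, pᵉ) mod p⁴ is the same for all e ≥ 1. -/

/-- The polynomial `(X + 1)(X + 2)⋯(X + n)` over the integers. -/
noncomputable def risingPoly (n : ℕ) : ℤ[X] := ∏ i ∈ range n, (X + C ((i : ℤ) + 1))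

theorem risingPoly_eval (n : ℕ) (x : ℤ) :
    (risingPoly n).eval x = ∏ i ∈ range n, (x + ((i : ℤ) + 1)) := by
  simp [risingPoly, eval_prod]

theorem risingPoly_eval_zero (n : ℕ) : (risingPoly n).eval 0 = (n ! : ℤ) := by
  rw [risingPoly_eval, ← prod_range_add_one_eq_factorial]
  push_cast
  simp

/-- Reflection symmetry of an even number of consecutive linear factors. -/
theorem risingPoly_eval_reflect {n : ℕ} (hn : Even n) (x : ℤ) :
    (risingPoly n).eval (-((n : ℤ) + 1) - x) = (risingPoly n).eval x := by
  rw [risingPoly_eval, risingPoly_eval, ← prod_range_reflect]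
  have h : ∀ i ∈ range n, -((n : ℤ) + 1) - x + (((n - 1 - i : ℕ) : ℤ) + 1)
      = -1 * (x + ((i : ℤ) + 1)) := by
    intro i hi
    have : i < n := mem_range.1 hi
    have h2 : ((n - 1 - i : ℕ) : ℤ) = n - 1 - i := by omega
    rw [h2]; ring
  rw [prod_congr rfl h, prod_mul_distrib, prod_const, card_range, hn.neg_one_pow, one_mul]

/-- Both sides are monic of degree p - 1 and vanish at every nonzero residue. -/
theorem risingPoly_map_zmod (p : ℕ) [hp : Fact p.Prime] :
    (risingPoly (p - 1)).map (Int.castRingHom (ZMod p)) = X ^ (p - 1) - 1 := by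
  have hp2 := hp.out.two_le
  have hmap : (risingPoly (p - 1)).map (Int.castRingHom (ZMod p))
      = ∏ i ∈ range (p - 1), (X + C ((i : ZMod p) + 1)) := by
    simp [risingPoly, Polynomial.map_prod]
  have hd1 : (∏ i ∈ range (p - 1), (X + C ((i : ZMod p) + 1))).degree = ((p - 1 : ℕ) : WithBot ℕ) := by
    rw [degree_prod]
    simp only [degree_X_add_C]
    simp
  have hm1 : (∏ i ∈ range (p - 1), (X + C ((i : ZMod p) + 1))).Monic :=
    monic_prod_of_monic _ _ fun i _ => monic_X_add_C _
  have hd2 : (X ^ (p - 1) - 1 : (ZMod p)[X]).degree = ((p - 1 : ℕ) : WithBot ℕ) := by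
    simpa using degree_X_pow_sub_C (R := ZMod p) (n := p - 1) (by omega) 1
  have hm2 : (X ^ (p - 1) - 1 : (ZMod p)[X]).Monic := by
    simpa using monic_X_pow_sub_C (R := ZMod p) (n := p - 1) 1 (by omega)
  have hcard : #(univ.erase (0 : ZMod p)) = p - 1 := by
    rw [card_erase_of_mem (mem_univ _), card_univ, ZMod.card]
  rw [hmap]
  refine Polynomial.eq_of_degree_le_of_eval_finset_eq (univ.erase (0 : ZMod p)) ?_ ?_ ?_ ?_
  · rw [hd1, hcard]
  · rw [hd1, hd2]
  · rw [hm1.leadingCoeff, hm2.leadingCoeff]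
  · intro x hx
    have hx0 : x ≠ 0 := (mem_erase.1 hx).1
    have hv : (-x).val ≠ 0 := by simpa [ZMod.val_eq_zero] using hx0
    have hlt := ZMod.val_lt (-x)
    rw [eval_prod, prod_eq_zero (i := (-x).val - 1) (mem_range.2 (by omega))]
    · simp [ZMod.pow_card_sub_one_eq_one hx0]
    · have h1 : (((-x).val - 1 : ℕ) : ZMod p) + 1 = -x := by
        rw [← Nat.cast_add_one, Nat.sub_add_cancel (by omega), ZMod.natCast_zmod_val]
      rw [eval_add, eval_X, eval_C, h1, add_neg_cancel]

theorem prime_dvd_risingPoly_coeff {p : ℕ} (hp : p.Prime) {i : ℕ} (hi : i ≠ 0) (hip : i < p - 1) :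
    (p : ℤ) ∣ (risingPoly (p - 1)).coeff i := by
  have := Fact.mk hp
  have h := congrArg (fun q => q.coeff i) (risingPoly_map_zmod p)
  simp only [coeff_map, coeff_sub, coeff_X_pow, coeff_one, hi, hip.ne, if_false, sub_zero] at h
  exact (ZMod.intCast_zmod_eq_zero_iff_dvd _ p).1 h

theorem eval_eq_cubic_add (q : ℤ[X]) (x : ℤ) : ∃ r : ℤ,
    q.eval x = q.coeff 0 + q.coeff 1 * x + q.coeff 2 * x ^ 2 + q.coeff 3 * x ^ 3 + r * x ^ 4 := by
  refine ⟨q.divX.divX.divX.divX.eval x, ?_⟩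
  have h (s : ℤ[X]) : s.eval x = s.divX.eval x * x + s.coeff 0 := by
    conv_lhs => rw [← divX_mul_X_add s]
    simp
  rw [h q, h q.divX, h q.divX.divX, h q.divX.divX.divX]
  simp only [coeff_divX]
  ring

/-- Modulo `p ^ 4`, the product of the `p - 1` integers strictly between `k p` and `(k + 1) p`
is a quadratic polynomial in `k` whose leading coefficient is divisible by `p ^ 3`. -/
theorem exists_block_modEq {p : ℕ} (hp : p.Prime) (hp5 : 5 ≤ p) : ∃ a : ℤ, ∀ k : ℤ,
    (risingPoly (p - 1)).eval (k * p) ≡ ((p - 1)! : ℤ) + p ^ 3 * a * (k * (k + 1))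
      [ZMOD (p : ℤ) ^ 4] := by
  set q := risingPoly (p - 1) with hq
  obtain ⟨b, hb⟩ := prime_dvd_risingPoly_coeff hp (i := 1) (by omega) (by omega)
  obtain ⟨c, hc⟩ := prime_dvd_risingPoly_coeff hp (i := 2) (by omega) (by omega)
  obtain ⟨d, hd⟩ := prime_dvd_risingPoly_coeff hp (i := 3) (by omega) (by omega)
  rw [← hq] at hb hc hd
  have h0 : q.coeff 0 = ((p - 1)! : ℤ) := by
    rw [coeff_zero_eq_eval_zero, hq, risingPoly_eval_zero]
  have hp0 : (p : ℤ) ≠ 0 := by exact_mod_cast hp.ne_zero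
  have hodd : Even (p - 1) := by
    rcases hp.eq_two_or_odd' with h | h
    · omega
    · obtain ⟨t, ht⟩ := h
      exact ⟨t, by omega⟩
  have hrefl : q.eval (-1 * (p : ℤ)) = q.eval 0 := by
    have h := risingPoly_eval_reflect hodd 0
    have h1 : ((p - 1 : ℕ) : ℤ) + 1 = p := by omega
    rwa [h1, sub_zero, ← neg_one_mul] at h
  obtain ⟨r, hr⟩ := eval_eq_cubic_add q (-1 * (p : ℤ))
  rw [hrefl, ← coeff_zero_eq_eval_zero, hb, hc, hd] at hr
  -- Divide q(-p) = q(0) by p².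
  have hbc : b = p * (c + p * (r - d)) := by
    apply mul_left_cancel₀ (pow_ne_zero 2 hp0)
    linear_combination hr
  refine ⟨c, fun k => ?_⟩
  obtain ⟨s, hs⟩ := eval_eq_cubic_add q (k * p)
  rw [hs, h0, hb, hc, hd]
  refine (Int.modEq_iff_dvd.2 ⟨-((r - d) * k + d * k ^ 3 + s * k ^ 4), ?_⟩)
  rw [hbc]
  ring

/-- The product of the positive integers below `n p` that are not divisible by `p`,
arranged in `n` blocks of length `p - 1`. -/
noncomputable def blockProd (p n : ℕ) : ℤ :=
  ∏ k ∈ range n, (risingPoly (p - 1)).eval ((k : ℤ) * p)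

theorem factorial_mul_eq {p : ℕ} (hp : 0 < p) (n : ℕ) :
    ((n * p)! : ℤ) = p ^ n * n ! * blockProd p n := by
  induction n with
  | zero => simp [blockProd]
  | succ n ih =>
    obtain ⟨t, rfl⟩ : ∃ t, p = t + 1 := ⟨p - 1, by omega⟩
    have h := Nat.factorial_mul_ascFactorial (n * (t + 1)) (t + 1)
    rw [Nat.ascFactorial_eq_prod_range, prod_range_succ] at h
    have h' := congrArg (Nat.cast : ℕ → ℤ) h
    rw [add_one_mul, ← h']
    have hG : blockProd (t + 1) (n + 1) = blockProd (t + 1) n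
        * ∏ i ∈ range t, ((n : ℤ) * (t + 1 : ℕ) + ((i : ℤ) + 1)) := by
      rw [blockProd, prod_range_succ, risingPoly_eval]
      rfl
    rw [hG, Nat.factorial_succ]
    have hP : (∏ i ∈ range t, ((n : ℤ) * (t + 1) + 1 + i))
        = ∏ i ∈ range t, ((n : ℤ) * (t + 1) + ((i : ℤ) + 1)) :=
      prod_congr rfl fun i _ => by ring
    push_cast at ih ⊢
    rw [ih, hP]
    ring

theorem choose_mul_blockProd {p : ℕ} (hp : 0 < p) (a b : ℕ) :
    (((a + b) * p).choose (a * p) : ℤ) * (blockProd p a * blockProd p b)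
      = (a + b).choose a * blockProd p (a + b) := by
  have h1 := congrArg (Nat.cast : ℕ → ℤ)
    (Nat.add_choose_mul_factorial_mul_factorial (a * p) (b * p))
  have h2 := congrArg (Nat.cast : ℕ → ℤ) (Nat.add_choose_mul_factorial_mul_factorial a b)
  rw [← Nat.choose_symm_add, ← add_mul] at h1
  rw [← Nat.choose_symm_add] at h2
  push_cast at h1 h2
  rw [factorial_mul_eq hp, factorial_mul_eq hp, factorial_mul_eq hp, ← h2] at h1
  have hne : (p : ℤ) ^ (a + b) * a ! * b ! ≠ 0 := by
    have : (p : ℤ) ≠ 0 := by exact_mod_cast hp.ne'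
    have := Nat.factorial_ne_zero a
    have := Nat.factorial_ne_zero b
    positivity
  apply mul_left_cancel₀ hne
  linear_combination h1

theorem three_mul_sum_range (n : ℕ) :
    3 * ∑ k ∈ range n, ((k : ℤ) * (k + 1)) = n * (n ^ 2 - 1) := by
  induction n with
  | zero => simp
  | succ n ih => rw [sum_range_succ, mul_add, ih]; push_cast; ring

theorem prime_dvd_sum_range {p : ℕ} (hp : p.Prime) (hp5 : 5 ≤ p) {n : ℕ} (hn : p ∣ n) :
    (p : ℤ) ∣ ∑ k ∈ range n, ((k : ℤ) * (k + 1)) := by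
  have h : (p : ℤ) ∣ 3 * ∑ k ∈ range n, ((k : ℤ) * (k + 1)) := by
    rw [three_mul_sum_range]
    exact (Int.natCast_dvd_natCast.2 hn).mul_right _
  refine ((Nat.prime_iff_prime_int.1 hp).dvd_or_dvd h).resolve_left fun h3 => ?_
  have : p ∣ 3 := by exact_mod_cast h3
  exact absurd (Nat.le_of_dvd (by norm_num) this) (by omega)

/-- The extra factor (p-1)! avoids the exponent n - 1; cross terms carry p⁶. -/
theorem blockProd_modEq {p : ℕ} {a : ℤ} (ha : ∀ k : ℤ,
    (risingPoly (p - 1)).eval (k * p) ≡ ((p - 1)! : ℤ) + p ^ 3 * a * (k * (k + 1))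
      [ZMOD (p : ℤ) ^ 4]) (n : ℕ) :
    ((p - 1)! : ℤ) * blockProd p n ≡ ((p - 1)! : ℤ) ^ n *
      ((p - 1)! + p ^ 3 * a * ∑ k ∈ range n, ((k : ℤ) * (k + 1))) [ZMOD (p : ℤ) ^ 4] := by
  induction n with
  | zero => simp [blockProd]
  | succ n ih =>
    rw [blockProd, prod_range_succ, ← blockProd, ← mul_assoc, sum_range_succ]
    refine (ih.mul (ha n)).trans (Int.modEq_iff_dvd.2 ⟨-(((p - 1)! : ℤ) ^ n * p ^ 2 * a ^ 2
      * (∑ k ∈ range n, ((k : ℤ) * (k + 1))) * (n * (n + 1))), ?_⟩)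
    ring

theorem isCoprime_pow_four_factorial {p : ℕ} (hp : p.Prime) (n : ℕ) :
    IsCoprime ((p : ℤ) ^ 4) (((p - 1)! : ℤ) ^ n) := by
  have h : Nat.Coprime (p ^ 4) ((p - 1)! ^ n) := by
    refine Nat.Coprime.pow _ _ ((Nat.Prime.coprime_iff_not_dvd hp).2 fun h => ?_)
    have := (Nat.Prime.dvd_factorial hp).1 h
    have := hp.pos
    omega
  exact_mod_cast Nat.isCoprime_iff_coprime.2 h

theorem Int.ModEq.cancel_left_of_isCoprime {m a b c : ℤ} (hc : IsCoprime m c)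
    (h : c * a ≡ c * b [ZMOD m]) : a ≡ b [ZMOD m] := by
  rw [Int.modEq_iff_dvd, ← mul_sub] at h
  exact Int.modEq_iff_dvd.2 (hc.dvd_of_dvd_mul_left h)

theorem blockProd_modEq_pow {p : ℕ} (hp : p.Prime) {a : ℤ} (ha : ∀ k : ℤ,
    (risingPoly (p - 1)).eval (k * p) ≡ ((p - 1)! : ℤ) + p ^ 3 * a * (k * (k + 1))
      [ZMOD (p : ℤ) ^ 4]) {n : ℕ}
    (hn : (p : ℤ) ∣ a * ∑ k ∈ range n, ((k : ℤ) * (k + 1))) :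
    blockProd p n ≡ ((p - 1)! : ℤ) ^ n [ZMOD (p : ℤ) ^ 4] := by
  have hc := isCoprime_pow_four_factorial hp 1
  rw [pow_one] at hc
  refine Int.ModEq.cancel_left_of_isCoprime hc ((blockProd_modEq ha n).trans ?_)
  obtain ⟨t, ht⟩ := hn
  refine Int.modEq_iff_dvd.2 ⟨-(((p - 1)! : ℤ) ^ n * t), ?_⟩
  linear_combination -((p - 1)! : ℤ) ^ n * p ^ 3 * ht

/-- `binom(n p, m p) ≡ binom(n, m) (mod p ^ 4)` as soon as the correction terms vanish. -/
theorem choose_mul_modEq {p : ℕ} (hp : p.Prime) {a : ℤ} (ha : ∀ k : ℤ,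
    (risingPoly (p - 1)).eval (k * p) ≡ ((p - 1)! : ℤ) + p ^ 3 * a * (k * (k + 1))
      [ZMOD (p : ℤ) ^ 4]) {P : ℕ → Prop}
    (hP : ∀ n, P n → (p : ℤ) ∣ a * ∑ k ∈ range n, ((k : ℤ) * (k + 1)))
    {i j : ℕ} (hi : P i) (hj : P j) (hij : P (i + j)) :
    ((i + j) * p).choose (i * p) ≡ (i + j).choose i [MOD p ^ 4] := by
  have key := choose_mul_blockProd hp.pos i j
  have gi := blockProd_modEq_pow hp ha (hP i hi)
  have gj := blockProd_modEq_pow hp ha (hP j hj)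
  have gij := blockProd_modEq_pow hp ha (hP _ hij)
  rw [← Int.natCast_modEq_iff]
  push_cast
  refine Int.ModEq.cancel_left_of_isCoprime (isCoprime_pow_four_factorial hp (i + j)) ?_
  rw [mul_comm, mul_comm _ ((i + j).choose i : ℤ)]
  have h1 := ((gi.mul gj).mul_left (((i + j) * p).choose (i * p) : ℤ)).symm
  rw [← pow_add, key] at h1
  exact h1.trans (gij.mul_left _)

theorem dvd_of_choose_two_mul_modEq {p : ℕ} (hp : p.Prime) (hp5 : 5 ≤ p) {a : ℤ}
    (ha : ∀ k : ℤ,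
      (risingPoly (p - 1)).eval (k * p) ≡ ((p - 1)! : ℤ) + p ^ 3 * a * (k * (k + 1))
        [ZMOD (p : ℤ) ^ 4])
    (h : (2 * p).choose p ≡ 2 [MOD p ^ 4]) : (p : ℤ) ∣ a := by
  have key := choose_mul_blockProd hp.pos 1 1
  have g1 := blockProd_modEq_pow hp ha (n := 1) (by simp)
  have g2 := blockProd_modEq ha 2
  have h' : ((2 * p).choose p : ℤ) ≡ 2 [ZMOD (p : ℤ) ^ 4] := by
    have := Int.natCast_modEq_iff.2 h
    exact_mod_cast this
  norm_num [sum_range_succ] at key g1 g2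
  have e1 := (h'.mul (g1.mul g1)).mul_left ((p - 1)! : ℤ)
  rw [key] at e1
  have e2 := (e1.symm.trans (by
    simpa [mul_left_comm] using g2.mul_left 2 :
      ((p - 1)! : ℤ) * (2 * blockProd p 2) ≡
        2 * (((p - 1)! : ℤ) ^ 2 * ((p - 1)! + p ^ 3 * a * 2)) [ZMOD (p : ℤ) ^ 4]))
  -- The 4 is binom(2, 1)·S(2), with S(2) = 2.
  have e3 : (p : ℤ) ^ 4 ∣ ((p - 1)! : ℤ) ^ 2 * (p ^ 3 * (4 * a)) := by
    have := Int.modEq_iff_dvd.1 e2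
    ring_nf at this ⊢
    exact this
  have e4 := (isCoprime_pow_four_factorial hp 2).dvd_of_dvd_mul_left e3
  rw [pow_succ] at e4
  have hp0 : (p : ℤ) ≠ 0 := by exact_mod_cast hp.ne_zero
  have e5 := Int.dvd_of_mul_dvd_mul_left (pow_ne_zero 3 hp0) e4
  refine ((Nat.prime_iff_prime_int.1 hp).dvd_or_dvd e5).resolve_left fun h4 => ?_
  have : p ∣ 4 := by exact_mod_cast h4
  exact absurd (Nat.le_of_dvd (by norm_num) this) (by omega)

theorem choose_mul_pow_modEq {p : ℕ}
    (h : ∀ n m : ℕ, (n * p).choose (m * p) ≡ n.choose m [MOD p ^ 4]) (n m e : ℕ) :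
    (n * p ^ e).choose (m * p ^ e) ≡ n.choose m [MOD p ^ 4] := by
  induction e with
  | zero => simpa using Nat.ModEq.refl _
  | succ e ih =>
    rw [pow_succ p e, ← mul_assoc, ← mul_assoc]
    exact (h _ _).trans ih

theorem choose_two_mul_pow_modEq {p : ℕ} (hp : p.Prime) (hp5 : 5 ≤ p) (e : ℕ) :
    (2 * p ^ (e + 1)).choose (p ^ (e + 1)) ≡ (2 * p).choose p [MOD p ^ 4] := by
  obtain ⟨a, ha⟩ := exists_block_modEq hp hp5
  induction e with
  | zero => simpa using Nat.ModEq.refl _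
  | succ e ih =>
    have hd : p ∣ p ^ (e + 1) := dvd_pow_self p e.succ_ne_zero
    have h := choose_mul_modEq hp ha (P := fun n => p ∣ n)
      (fun n hn => (prime_dvd_sum_range hp hp5 hn).mul_left a) hd hd (dvd_add hd hd)
    rw [← two_mul, mul_assoc, ← pow_succ] at h
    exact h.trans ih

/-- From r·binom(N, r) = N·binom(N-1, r-1), with r prime to p. -/
theorem prime_pow_dvd_choose {p e N r : ℕ} (hp : p.Prime) (hN : p ^ e ∣ N) (hr : ¬ p ∣ r) :
    p ^ e ∣ N.choose r := by
  obtain rfl | ⟨s, rfl⟩ : r = 0 ∨ ∃ s, r = s + 1 := by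
    cases r <;> simp
  · simp at hr
  cases N with
  | zero => simp
  | succ N =>
    have h := Nat.add_one_mul_choose_eq N s
    refine (((Nat.Prime.coprime_iff_not_dvd hp).2 hr).pow_left e).dvd_of_dvd_mul_right ?_
    rw [← h]
    exact hN.mul_right _

/-- In Vandermonde's sum a surviving term has p ∣ i, so j ≡ m₀ mod p; as j ≤ n₀ < p, this forces j =
m₀. -/
theorem choose_add_modEq {p e N M n₀ m₀ : ℕ} (hp : p.Prime) (he : e ≠ 0) (hN : p ^ e ∣ N)
    (hM : p ^ e ∣ M) (hn : n₀ < p) (hm : m₀ < p) :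
    (N + n₀).choose (M + m₀) ≡ N.choose M * n₀.choose m₀ [MOD p ^ e] := by
  rw [Nat.add_choose_eq,
    ← add_sum_erase _ _ (show (M, m₀) ∈ antidiagonal (M + m₀) from HasAntidiagonal.mem_antidiagonal.2 rfl)]
  refine (Nat.modEq_iff_dvd' (Nat.le_add_right _ _)).2 ?_ |>.symm
  rw [Nat.add_sub_cancel_left]
  refine dvd_sum fun x hx => ?_
  obtain ⟨i, j⟩ := x
  simp only [mem_erase, HasAntidiagonal.mem_antidiagonal, ne_eq, Prod.mk.injEq] at hx
  obtain ⟨hne, hsum⟩ := hx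
  rcases lt_or_ge n₀ j with hj | hj
  · simp [Nat.choose_eq_zero_of_lt hj]
  refine (prime_pow_dvd_choose hp hN fun hi => hne ?_).mul_right _
  have hpM : p ∣ M := (dvd_pow_self p he).trans hM
  have hmod : j ≡ m₀ [MOD p] := by
    have h1 : i + j ≡ 0 + j [MOD p] := ((Nat.modEq_zero_iff_dvd).2 hi).add_right j
    have h2 : M + m₀ ≡ 0 + m₀ [MOD p] := ((Nat.modEq_zero_iff_dvd).2 hpM).add_right m₀
    rw [hsum] at h1
    simpa using h1.symm.trans h2
  have hjm : j = m₀ := hmod.eq_of_lt_of_lt (by omega) hm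
  omega

theorem choose_two_mul_eq {p : ℕ} (hp : 0 < p) :
    (2 * p).choose p = 2 * (2 * p - 1).choose (p - 1) := by
  obtain ⟨t, rfl⟩ : ∃ t, p = t + 1 := ⟨p - 1, by omega⟩
  have h : 2 * (t + 1) - 1 = 2 * t + 1 := by omega
  have h' : 2 * (t + 1) = (2 * t + 1) + 1 := by omega
  rw [h, h', Nat.choose_succ_succ, Nat.choose_symm_half, Nat.add_sub_cancel]
  omega

theorem mainTheorem2 (p : ℕ) (hp : p.Prime) (hp5 : 5 ≤ p) :
    List.TFAE [
      IsWolstenholmePrime p,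
      (2 * p).choose p ≡ 2 [MOD p ^ 4],
      ∀ n m : ℕ, (n * p).choose (m * p) ≡ n.choose m [MOD p ^ 4],
      ∀ n m n₀ m₀ : ℕ, n₀ < p → m₀ < p →
        (n * p ^ 4 + n₀).choose (m * p ^ 4 + m₀) ≡ n.choose m * n₀.choose m₀ [MOD p ^ 4]] := by
  tfae_have 1 ↔ 2 := by
    rw [IsWolstenholmePrime, choose_two_mul_eq hp.pos]
    refine ⟨fun h => by simpa using h.2.mul_left 2, fun h => ⟨hp, ?_⟩⟩
    have hc : Nat.gcd (p ^ 4) 2 = 1 := by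
      refine Nat.Coprime.pow_left 4 ((Nat.coprime_primes hp Nat.prime_two).2 (by omega))
    exact Nat.ModEq.cancel_left_of_coprime hc (by simpa using h)
  tfae_have 2 → 3 := by
    intro h n m
    obtain ⟨a, ha⟩ := exists_block_modEq hp hp5
    have hpa := dvd_of_choose_two_mul_modEq hp hp5 ha h
    rcases lt_or_ge n m with hnm | hnm
    · rw [Nat.choose_eq_zero_of_lt hnm,
        Nat.choose_eq_zero_of_lt (Nat.mul_lt_mul_of_pos_right hnm hp.pos)]
    · obtain ⟨j, rfl⟩ := Nat.exists_eq_add_of_le hnm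
      exact choose_mul_modEq hp ha (P := fun _ => True) (fun n _ => hpa.mul_right _)
        trivial trivial trivial
  tfae_have 3 → 4 := by
    intro h n m n₀ m₀ hn hm
    exact (choose_add_modEq hp four_ne_zero (dvd_mul_left _ _) (dvd_mul_left _ _) hn hm).trans
      ((choose_mul_pow_modEq h n m 4).mul_right _)
  tfae_have 4 → 2 := by
    intro h
    have h1 := h 2 1 0 0 hp.pos hp.pos
    simp only [add_zero, one_mul, Nat.choose_self, mul_one, Nat.choose_one_right] at h1
    exact (choose_two_mul_pow_modEq hp hp5 3).symm.trans h1
  tfae_finish
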